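/- **Setting.** Let $N^+=\mathbb{Z}_{\ge 0}^2\setminus\{(0,0)\}$, $\deg(a,b)=a+b$, and $\{(a,b),(c,d)\}=bc-ad$. Let $\mathfrak g=\bigoplus_{v\in N^+}\mathbb{Q}X_v$ be the Lie algebra with $[X_v,X_w]=\{v,w\}X_{v+w}$, and put $\mathfrak g^{>l}=\bigoplus_{\deg v>l}\mathbb{Q}X_v$ and $\mathfrak g^{\le l}=\mathfrak g/\mathfrak g^{>l}$. Let $G^{\le l}=\{\exp x\mid x\in\mathfrak g^{\le l}\}$ with the Baker–Campbell–Hausdorff product, $G=\varprojlim G^{\le l}$ with projections $\pi_l:G\to G^{\le l}$, and $(\exp x)^c=\exp(cx)$ for $c\in\mathbb{Q}$. Write $g\equiv g' \bmod G^{>l}$ when $\pi_l(g)=\pi_l(g')$. For $(a,b)\in N^+$ let $$\Psi[a,b]=\exp\Bigl(\sum_{j\ge 1}\tfrac{(-1)^{j+1}}{j^2}X_{(ja,jb)}\Bigr)\in G .$$ Order $N^+$ by $v\le w$ iff $\{v,w\}<0$ or $w=kv$ for some rational $k\ge 1$. A (possibly infinite) product of rational powers of elements $\Psi[v_j]$ is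 called *ordered* if the $v_j$ are strictly increasing from left to right. For a matrix $F$ over $\mathbb{Z}_{\ge 0}$ with $|F|=\det F\neq 0$ put $F\,\Psi[v]=\Psi[Fv]^{1/|F|}$. **Statement.** Let $F=\begin{pmatrix}a&c\\ b&d\end{pmatrix}$ with $(a,b),(c,d)\in N^+$, $|F|>0$ and $F\ne\begin{pmatrix}1&0\\0&1\end{pmatrix}$. Let $m,n,l\in\mathbb{Z}_{>0}$, and let $$C=\Psi[1,0]^m\Bigl\{\prod_{j\in J}\Psi[a_j,b_j]^{u_j}\Bigr\}\Psi[0,1]^n\qquad(u_j\in\mathbb{Q})$$ be an ordered product (over a totally ordered index set $J$) with $$\Psi[0,1]^n\,\Psi[1,0]^m\equiv C \mod G^{>l}.$$ (In particular this holds, for every $l$, if $C$ is the ordered product that is equal to $\Psi[0,1]^n\Psi[1,0]^m$ in $G$.) Then only finitely many $j\in J$ satisfy $\deg(a_j,b_j)\le l$ and $\deg F\binom{a_j}{b_j}\le l+1$, and $$\Psi[c,d]^{n/|F|}\,\Psi[a,b]^{m/|F|}\equiv \Psi[a,b]^{m/|F|}\Bigl\{\prod_{\substack{j\in J,\ \deg(a_j,b_j)\le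 l,\\ \deg F\binom{a_j}{b_j}\le l+1}}\bigl(F\,\Psi[a_j,b_j]\bigr)^{u_j}\Bigr\}\Psi[c,d]^{n/|F|}\mod G^{>l+1},$$ where the factors are taken in the order of $J$ and the product on the right-hand side is again ordered. -/

import Mathlib

noncomputable section

namespace Dilog

/-! ### The monoid of positive vectors -/

/-- `N⁺ = ℤ_{≥0}² ∖ {0}`; the vector `a e₁ + b e₂` is `![a, b]`. -/
abbrev Nplus : Type := {v : Fin 2 → ℕ // v ≠ 0}

/-- `deg (a, b) = a + b`. -/
def deg (v : Nplus) : ℕ := v.1 0 + v.1 1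

theorem deg_pos (v : Nplus) : 0 < deg v := by
  rcases v with ⟨v, hv⟩
  by_contra h
  apply hv
  have h' : v 0 + v 1 = 0 := by simpa [deg] using h
  funext i
  fin_cases i <;> simp <;> omega

instance : Add Nplus :=
  ⟨fun v w => ⟨v.1 + w.1, fun h => v.2 (by
    funext i
    have := congrFun h i
    simp only [Pi.add_apply, Pi.zero_apply] at this ⊢
    omega)⟩⟩

theorem deg_add (v w : Nplus) : deg (v + w) = deg v + deg w := by
  change (v.1 + w.1) 0 + (v.1 + w.1) 1 = (v.1 0 + v.1 1) + (w.1 0 + w.1 1)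
  simp only [Pi.add_apply]
  omega

/-- The multiple `j v` of `v ∈ N⁺` by an integer `j ≥ 1`. -/
def nmul (j : ℕ+) (v : Nplus) : Nplus :=
  ⟨(j : ℕ) • v.1, smul_ne_zero j.pos.ne' v.2⟩

theorem deg_nmul (j : ℕ+) (v : Nplus) : deg (nmul j v) = j * deg v := by
  simp [deg, nmul, mul_add]

/-- The skew-symmetric form `{(a, b), (c, d)} = b c - a d`, normalised by `{e₂, e₁} = 1`. -/
def skew (v w : Nplus) : ℤ := (v.1 1 : ℤ) * w.1 0 - (v.1 0 : ℤ) * w.1 1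

/-- The order on `N⁺`: `v ≤ w` iff `{v, w} < 0`, or `w = k v` for some rational `k ≥ 1`. -/
def DilogLE (v w : Nplus) : Prop :=
  skew v w < 0 ∨ ∃ k : ℚ, 1 ≤ k ∧ ∀ i, (w.1 i : ℚ) = k * v.1 i

/-- The strict order `v < w` attached to `DilogLE`. -/
def DilogLT (v w : Nplus) : Prop := DilogLE v w ∧ v ≠ w

/-! ### The graded Lie algebra -/

/-- `𝔤 = ⨁_{v ∈ N⁺} ℚ X_v`. -/
abbrev LieAlg : Type := Nplus →₀ ℚ

namespace LieAlg

/-- The generator `X_v`. -/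
def X (v : Nplus) : LieAlg := Finsupp.single v 1

/-- The coefficient of `X_v`. -/
def coeff (v : Nplus) : LieAlg →ₗ[ℚ] ℚ := Finsupp.lapply v

/-- The bilinear map with `X_v, X_w ↦ {v, w} X_{v + w}`. -/
def bracketLin : LieAlg →ₗ[ℚ] LieAlg →ₗ[ℚ] LieAlg :=
  Finsupp.lift (LieAlg →ₗ[ℚ] LieAlg) ℚ Nplus fun v =>
    Finsupp.lift LieAlg ℚ Nplus fun w => (skew v w : ℚ) • X (v + w)

theorem bracketLin_X (v w : Nplus) : bracketLin (X v) (X w) = (skew v w : ℚ) • X (v + w) := by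
  rw [bracketLin, X, X, Finsupp.lift_apply, Finsupp.sum_single_index (by simp), one_smul,
    Finsupp.lift_apply, Finsupp.sum_single_index (by simp), one_smul]

/-- Linear maps out of `𝔤` agree once they agree on the generators. -/
theorem hom_ext {M : Type*} [AddCommMonoid M] [Module ℚ M] {f g : LieAlg →ₗ[ℚ] M}
    (h : ∀ v, f (X v) = g (X v)) : f = g :=
  Finsupp.lhom_ext' fun v => LinearMap.ext_ring (h v)

theorem skew_comm (v w : Nplus) : skew v w = -skew w v := by
  unfold skew; ring

theorem skew_add_left (u v w : Nplus) : skew (u + v) w = skew u w + skew v w := by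
  change (((u.1 + v.1) 1 : ℕ) : ℤ) * w.1 0 - (((u.1 + v.1) 0 : ℕ) : ℤ) * w.1 1 = _
  simp only [Pi.add_apply, skew]; push_cast; ring

theorem skew_add_right (u v w : Nplus) : skew u (v + w) = skew u v + skew u w := by
  rw [skew_comm, skew_add_left, skew_comm v, skew_comm w]; ring

theorem nplus_add_comm (v w : Nplus) : v + w = w + v := Subtype.ext (add_comm v.1 w.1)

theorem nplus_add_assoc (u v w : Nplus) : u + v + w = u + (v + w) :=
  Subtype.ext (add_assoc u.1 v.1 w.1)

theorem bracketLin_swap (x y : LieAlg) : bracketLin x y = -bracketLin y x := by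
  have h : bracketLin = -bracketLin.flip := by
    refine hom_ext fun v => hom_ext fun w => ?_
    simp only [LinearMap.neg_apply, LinearMap.flip_apply, bracketLin_X]
    rw [skew_comm v w, nplus_add_comm v w]
    push_cast
    rw [neg_smul]
  exact LinearMap.congr_fun (LinearMap.congr_fun h x) y

theorem bracketLin_jacobi (x y z : LieAlg) :
    bracketLin x (bracketLin y z) =
      bracketLin (bracketLin x y) z + bracketLin y (bracketLin x z) := by
  let A : LieAlg →ₗ[ℚ] LieAlg →ₗ[ℚ] LieAlg →ₗ[ℚ] LieAlg :=
    LinearMap.mk₂ ℚ (fun x y => bracketLin x ∘ₗ bracketLin y)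
      (by intros; ext; simp) (by intros; ext; simp) (by intros; ext; simp) (by intros; ext; simp)
  let B : LieAlg →ₗ[ℚ] LieAlg →ₗ[ℚ] LieAlg →ₗ[ℚ] LieAlg :=
    LinearMap.mk₂ ℚ (fun x y => bracketLin (bracketLin x y))
      (by intros; simp) (by intros; simp) (by intros; simp) (by intros; simp)
  have h : A = B + A.flip := by
    refine hom_ext fun u => hom_ext fun v => hom_ext fun w => ?_
    simp only [A, B, LinearMap.add_apply, LinearMap.flip_apply, LinearMap.mk₂_apply,
      LinearMap.comp_apply, bracketLin_X, map_smul, LinearMap.smul_apply, smul_smul]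
    rw [nplus_add_assoc u v w, show v + (u + w) = u + (v + w) by
      rw [← nplus_add_assoc, nplus_add_comm v u, nplus_add_assoc], ← add_smul]
    congr 1
    simp only [skew_add_left, skew_add_right]
    rw [skew_comm v u]
    push_cast
    ring
  exact LinearMap.congr_fun (LinearMap.congr_fun (LinearMap.congr_fun h x) y) z

instance : Bracket LieAlg LieAlg := ⟨fun x y => bracketLin x y⟩

theorem bracket_def (x y : LieAlg) : ⁅x, y⁆ = bracketLin x y := rfl

instance : LieRing LieAlg where
  add_lie x y z := by simp [bracket_def]
  lie_add x y z := by simp [bracket_def]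
  lie_self x := by
    have h := bracketLin_swap x x
    have h2 : (2 : ℚ) • bracketLin x x = 0 := by
      rw [two_smul]; nth_rewrite 1 [h]; simp
    exact (smul_eq_zero.mp h2).resolve_left (by norm_num)
  leibniz_lie x y z := bracketLin_jacobi x y z

instance : LieAlgebra ℚ LieAlg where
  lie_smul c x y := by simp [bracket_def]

theorem lie_X (v w : Nplus) : ⁅X v, X w⁆ = (skew v w : ℚ) • X (v + w) := bracketLin_X v w

/-- `𝔤^{>l}` as a subspace: the elements whose coefficients in degrees `≤ l` vanish. -/
def gtSubmodule (l : ℕ) : Submodule ℚ LieAlg where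
  carrier := {x | ∀ v, deg v ≤ l → coeff v x = 0}
  add_mem' hx hy v hv := by rw [map_add, hx v hv, hy v hv, add_zero]
  zero_mem' v _ := map_zero _
  smul_mem' c x hx v hv := by rw [map_smul, hx v hv, smul_zero]

theorem coeff_X (v w : Nplus) : coeff w (X v) = if v = w then 1 else 0 :=
  Finsupp.single_apply

theorem X_mem {l : ℕ} {v : Nplus} (h : l < deg v) : X v ∈ gtSubmodule l := by
  intro w hw
  rw [coeff_X, if_neg]
  rintro rfl
  omega

theorem gtSubmodule_eq_span (l : ℕ) :
    gtSubmodule l = Submodule.span ℚ (X '' {v | l < deg v}) := by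
  apply le_antisymm
  · intro x hx
    have hs : x = ∑ v ∈ x.support, coeff v x • X v := by
      refine (Finsupp.sum_single x).symm.trans (Finset.sum_congr rfl fun v _ => ?_)
      simp [coeff, X]
    rw [hs]
    refine Submodule.sum_mem _ fun v _ => ?_
    by_cases hv : deg v ≤ l
    · rw [hx v hv, zero_smul]; exact Submodule.zero_mem _
    · exact Submodule.smul_mem _ _ (Submodule.subset_span ⟨v, by simpa using hv, rfl⟩)
  · rw [Submodule.span_le]
    rintro _ ⟨v, hv, rfl⟩
    exact X_mem hv

theorem lie_mem {p q : ℕ} {x y : LieAlg} (hx : x ∈ gtSubmodule p) (hy : y ∈ gtSubmodule q) :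
    ⁅x, y⁆ ∈ gtSubmodule (p + q + 1) := by
  rw [gtSubmodule_eq_span] at hx hy
  refine Submodule.span_induction₂ (p := fun x y _ _ => ⁅x, y⁆ ∈ gtSubmodule (p + q + 1))
    ?_ ?_ ?_ ?_ ?_ ?_ ?_ hx hy
  · rintro _ _ ⟨v, hv, rfl⟩ ⟨w, hw, rfl⟩
    rw [lie_X]
    refine Submodule.smul_mem _ _ (X_mem ?_)
    rw [deg_add]
    simp only [Set.mem_ofPred_eq] at hv hw
    omega
  · intro y _; rw [zero_lie]; exact Submodule.zero_mem _
  · intro x _; rw [lie_zero]; exact Submodule.zero_mem _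
  · intro x y z _ _ _ h1 h2; rw [add_lie]; exact Submodule.add_mem _ h1 h2
  · intro x y z _ _ _ h1 h2; rw [lie_add]; exact Submodule.add_mem _ h1 h2
  · intro r x y _ _ h; rw [smul_lie]; exact Submodule.smul_mem _ _ h
  · intro r x y _ _ h; rw [lie_smul]; exact Submodule.smul_mem _ _ h

theorem mem_gt_zero (x : LieAlg) : x ∈ gtSubmodule 0 := fun v hv =>
  absurd (deg_pos v) (by omega)

theorem gtSubmodule_anti {l l' : ℕ} (h : l ≤ l') : gtSubmodule l' ≤ gtSubmodule l :=
  fun _ hx v hv => hx v (hv.trans h)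

/-- The ideal `𝔤^{>l} = ⨁_{deg v > l} ℚ X_v`. -/
def gt (l : ℕ) : LieIdeal ℚ LieAlg :=
  { gtSubmodule l with
    lie_mem := fun {x m} hm =>
      gtSubmodule_anti (by omega) (lie_mem (mem_gt_zero x) (q := l) hm) }

/-- The nilpotent Lie algebra `𝔤^{≤l} = 𝔤 / 𝔤^{>l}`. -/
abbrev Trunc (l : ℕ) : Type := LieAlg ⧸ gt l

/-- The class of `x ∈ 𝔤` in `𝔤^{≤l}`. -/
def mk (l : ℕ) (x : LieAlg) : Trunc l := LieSubmodule.Quotient.mk x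

theorem mk_lie (l : ℕ) (x y : LieAlg) : mk l ⁅x, y⁆ = ⁅mk l x, mk l y⁆ :=
  LieSubmodule.Quotient.mk_bracket (I := gt l) x y

theorem mk_surjective (l : ℕ) : Function.Surjective (mk l) :=
  LieSubmodule.Quotient.surjective_mk' (gt l)

theorem mk_eq_zero {l : ℕ} {x : LieAlg} : mk l x = 0 ↔ x ∈ gtSubmodule l :=
  LieSubmodule.Quotient.mk_eq_zero (N := gt l)

/-- The canonical projection `π_{l', l} : 𝔤^{≤l'} → 𝔤^{≤l}` for `l ≤ l'`. -/
def proj {l l' : ℕ} (h : l ≤ l') : Trunc l' →ₗ⁅ℚ⁆ Trunc l :=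
  { Submodule.mapQ (gtSubmodule l') (gtSubmodule l) LinearMap.id (gtSubmodule_anti h) with
    map_lie' := by
      intro x y
      obtain ⟨x, rfl⟩ := mk_surjective l' x
      obtain ⟨y, rfl⟩ := mk_surjective l' y
      rw [← mk_lie]
      exact mk_lie l x y }

theorem proj_mk {l l' : ℕ} (h : l ≤ l') (x : LieAlg) : proj h (mk l' x) = mk l x := rfl

end LieAlg

/-! ### The Baker–Campbell–Hausdorff product -/

section BCH

variable {L : Type*} [LieRing L]

/-- The right-nested bracket `[x₁, [x₂, …, [x_{k-1}, x_k]]]` of a word. -/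
def nested : List L → L
  | [] => 0
  | [x] => x
  | x :: y :: w => ⁅x, nested (y :: w)⁆

/-- Indices `(r₁, s₁), …, (r_k, s_k)` with `k ≥ 1` and all `r_i + s_i > 0`. -/
abbrev BCHIndex : Type := {p : List (ℕ × ℕ) // p ≠ [] ∧ ∀ q ∈ p, 0 < q.1 + q.2}

/-- The word `x^{r₁} y^{s₁} ⋯ x^{r_k} y^{s_k}`. -/
def bchWord {L : Type*} (x y : L) (p : List (ℕ × ℕ)) : List L :=
  p.flatMap fun q => List.replicate q.1 x ++ List.replicate q.2 y

/-- The rational number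
`(-1)^{k-1} / (k · ∑ (r_i + s_i) · ∏ r_i! s_i!)`. -/
def bchCoeff (p : List (ℕ × ℕ)) : ℚ :=
  (-1) ^ (p.length - 1) /
    ((p.length : ℚ) * ((p.map fun q => q.1 + q.2).sum : ℕ) *
      ((p.map fun q => q.1.factorial * q.2.factorial).prod : ℕ))

/-- One term of Dynkin's formula. -/
def bchTerm [LieAlgebra ℚ L] (x y : L) (p : BCHIndex) : L :=
  bchCoeff p.1 • nested (bchWord x y p.1)

/-- The Baker–Campbell–Hausdorff series `log (exp x · exp y)` in Dynkin's form. It is used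
in nilpotent Lie algebras only, where all but finitely many terms vanish. -/
def bch [LieAlgebra ℚ L] (x y : L) : L := ∑ᶠ p : BCHIndex, bchTerm x y p

theorem nested_map {L' : Type*} [LieRing L'] [LieAlgebra ℚ L] [LieAlgebra ℚ L']
    (f : L →ₗ⁅ℚ⁆ L') : ∀ w : List L, f (nested w) = nested (w.map f)
  | [] => by simp [nested]
  | [x] => by simp [nested]
  | x :: y :: w => by
    have := nested_map f (y :: w)
    simp only [nested, List.map_cons, LieHom.map_lie] at this ⊢
    rw [this]

theorem bchTerm_map {L' : Type*} [LieRing L'] [LieAlgebra ℚ L] [LieAlgebra ℚ L']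
    (f : L →ₗ⁅ℚ⁆ L') (x y : L) (p : BCHIndex) : f (bchTerm x y p) = bchTerm (f x) (f y) p := by
  simp only [bchTerm, map_smul, nested_map, bchWord, List.map_flatMap, List.map_append,
    List.map_replicate]

theorem length_bchWord {L : Type*} (x y : L) (p : List (ℕ × ℕ)) :
    (bchWord x y p).length = (p.map fun q => q.1 + q.2).sum := by
  simp [bchWord, List.length_flatMap]

theorem finite_bchIndex (n : ℕ) :
    {p : BCHIndex | (p.1.map fun q => q.1 + q.2).sum ≤ n}.Finite := by
  have hfin : (List.map (fun q : Fin (n + 1) × Fin (n + 1) => ((q.1 : ℕ), (q.2 : ℕ))) ''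
      {l | l.length ≤ n}).Finite := (List.finite_length_le _ n).image _
  refine Set.Finite.of_finite_image (hfin.subset ?_) Subtype.val_injective.injOn
  rintro _ ⟨⟨p, hne, hp⟩, hn, rfl⟩
  change (p.map fun q => q.1 + q.2).sum ≤ n at hn
  have hle : ∀ q ∈ p, q.1 + q.2 ≤ n := fun q hq =>
    (List.single_le_sum (by simp) _ (List.mem_map_of_mem (f := fun q : ℕ × ℕ => q.1 + q.2) hq)).trans
      hn
  refine ⟨p.map fun q => (Fin.ofNat (n + 1) q.1, Fin.ofNat (n + 1) q.2), ?_, ?_⟩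
  · have h1 : (p.map fun _ : ℕ × ℕ => 1).sum ≤ (p.map fun q => q.1 + q.2).sum :=
      List.sum_le_sum fun q hq => hp q hq
    simp only [List.map_const', List.sum_replicate, smul_eq_mul, mul_one] at h1
    simp only [Set.mem_ofPred_eq, List.length_map]
    omega
  · rw [List.map_map]
    refine (List.map_congr_left fun q hq => ?_).trans (List.map_id p)
    have := hle q hq
    ext <;> simp [Fin.ofNat] <;> omega

end BCH

namespace LieAlg

theorem nested_mem : ∀ (w : List LieAlg) (k : ℕ), k < w.length → nested w ∈ gtSubmodule k
  | [], k, h => by simp at h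
  | [x], k, h => by
    have : k = 0 := by simpa using h
    subst this
    exact mem_gt_zero x
  | x :: y :: w, k, h => by
    cases k with
    | zero => exact mem_gt_zero _
    | succ k =>
      have := lie_mem (mem_gt_zero x) (nested_mem (y :: w) k (by simpa using h))
      simpa [nested] using this

theorem nested_trunc {l : ℕ} (w : List (Trunc l)) (h : l < w.length) : nested w = 0 := by
  obtain ⟨w, rfl⟩ := (List.map_surjective_iff.mpr (mk_surjective l)) w
  have h0 : nested (w.map (mk l)) = mk l (nested w) := by
    clear h
    induction w with
    | nil => rfl
    | cons x w ih =>
      cases w with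
      | nil => rfl
      | cons y w =>
        simp only [List.map_cons, nested] at ih ⊢
        rw [ih, mk_lie]
  rw [h0, mk_eq_zero]
  exact nested_mem w l (by simpa using h)

/-- The Baker–Campbell–Hausdorff series is a finite sum in `𝔤^{≤l}`. -/
theorem finite_support_bchTerm {l : ℕ} (x y : Trunc l) :
    (Function.support (bchTerm x y)).Finite := by
  refine (finite_bchIndex l).subset fun p hp => ?_
  by_contra hlt
  refine hp ?_
  rw [bchTerm, nested_trunc, smul_zero]
  rw [length_bchWord]
  simpa using hlt

theorem proj_bch {l l' : ℕ} (h : l ≤ l') (x y : Trunc l') :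
    proj h (bch x y) = bch (proj h x) (proj h y) := by
  unfold bch
  refine ((proj h : Trunc l' →ₗ[ℚ] Trunc l).toAddMonoidHom.map_finsum
    (finite_support_bchTerm x y)).trans ?_
  exact finsum_congr fun p => bchTerm_map (proj h) x y p

end LieAlg

/-! ### The structure group -/

/-- `G^{≤l} = {exp x | x ∈ 𝔤^{≤l}}`. -/
@[ext]
structure TruncGroup (l : ℕ) where
  /-- The element `exp x`. -/
  exp ::
  /-- The logarithm. -/
  log : LieAlg.Trunc l

namespace TruncGroup

/-- `exp x · exp y = exp (x + y + [x, y] / 2 + ⋯)`. -/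
instance (l : ℕ) : Mul (TruncGroup l) := ⟨fun g h => exp (bch g.log h.log)⟩

instance (l : ℕ) : One (TruncGroup l) := ⟨exp 0⟩

/-- The canonical projection `G^{≤l'} → G^{≤l}` for `l ≤ l'`. -/
def proj {l l' : ℕ} (h : l ≤ l') (g : TruncGroup l') : TruncGroup l := exp (LieAlg.proj h g.log)

end TruncGroup

/-- The structure group `G = lim G^{≤l}`. -/
@[ext]
structure StructureGroup : Type where
  /-- The components `π_l g`. -/
  comp : ∀ l : ℕ, TruncGroup l
  /-- Compatibility with the projections. -/
  compat : ∀ l, TruncGroup.proj (Nat.le_succ l) (comp (l + 1)) = comp l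

namespace StructureGroup

instance : Mul StructureGroup :=
  ⟨fun g h => ⟨fun l => g.comp l * h.comp l, fun l => by
    rw [← g.compat l, ← h.compat l]
    exact congrArg TruncGroup.exp (LieAlg.proj_bch _ _ _)⟩⟩

instance : One StructureGroup :=
  ⟨⟨fun _ => 1, fun l => congrArg TruncGroup.exp (map_zero (LieAlg.proj (Nat.le_succ l)))⟩⟩

/-- Rational powers `(exp x)^c = exp (c x)`. -/
instance : Pow StructureGroup ℚ :=
  ⟨fun g c => ⟨fun l => TruncGroup.exp (c • (g.comp l).log), fun l => by
    rw [← g.compat l]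
    exact congrArg TruncGroup.exp (map_smul (LieAlg.proj (Nat.le_succ l)) c _)⟩⟩

/-- The canonical projection `π_l : G → G^{≤l}`. -/
def π (l : ℕ) (g : StructureGroup) : TruncGroup l := g.comp l

/-- `g ≡ h mod G^{>l}`. -/
def CongrMod (l : ℕ) (g h : StructureGroup) : Prop := π l g = π l h

/-- `g` is the (possibly infinite) product `∏_{j ∈ J} f j`, taken in the order of `J`: in every
`G^{≤l}` all but finitely many factors are trivial, and `g` is the product of the others. -/
def IsProd {J : Type*} [LinearOrder J] (f : J → StructureGroup) (g : StructureGroup) : Prop :=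
  ∀ l, ∃ S : Finset J, (∀ j, j ∉ S → π l (f j) = 1) ∧
    π l g = ((S.sort (· ≤ ·)).map fun j => π l (f j)).prod

/-- The finite product `∏_{j ∈ S} f j`, taken in the order of `J`. -/
def finProd {J : Type*} [LinearOrder J] (S : Finset J) (f : J → StructureGroup) :
    StructureGroup :=
  ((S.sort (· ≤ ·)).map f).prod

end StructureGroup

/-! ### Dilogarithm elements and similarity transformations -/

open LieAlg in
/-- The dilogarithm element `Ψ[v] = exp (∑_{j ≥ 1} (-1)^{j+1} / j² X_{jv})`. In `G^{≤l}` only the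
terms with `j ≤ l` matter, since `deg (j v) ≥ j`. -/
def dilog (v : Nplus) : StructureGroup :=
  ⟨fun l => TruncGroup.exp (LieAlg.mk l (∑ i ∈ Finset.range l,
      ((-1 : ℚ) ^ ((i.succPNat : ℕ) + 1) / ((i.succPNat : ℕ) : ℚ) ^ 2) • X (nmul i.succPNat v))),
    fun l => by
      refine congrArg TruncGroup.exp ((proj_mk (Nat.le_succ l) _).trans ?_)
      refine (Submodule.Quotient.eq (gtSubmodule l)).mpr ?_
      rw [Finset.sum_range_succ, add_sub_cancel_left]
      refine Submodule.smul_mem _ _ (X_mem ?_)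
      rw [deg_nmul]
      exact lt_of_lt_of_le (Nat.lt_succ_self l) (Nat.le_mul_of_pos_right _ (deg_pos v))⟩

/-- The determinant `|F|` of a matrix with entries in `ℤ_{≥0}`. -/
def detZ (F : Matrix (Fin 2) (Fin 2) ℕ) : ℤ := (F.map (Nat.cast : ℕ → ℤ)).det

/-- `F v ∈ N⁺` for `v ∈ N⁺` and `|F| ≠ 0`, by matrix multiplication. -/
def act (F : Matrix (Fin 2) (Fin 2) ℕ) (hF : detZ F ≠ 0) (v : Nplus) : Nplus :=
  ⟨F.mulVec v.1, fun h => v.2 (by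
    have h' : (F.map (Nat.cast : ℕ → ℤ)).mulVec (fun i => (v.1 i : ℤ)) = 0 := by
      funext i
      have := congrFun h i
      simp only [Matrix.mulVec, dotProduct, Matrix.map_apply, Pi.zero_apply] at this ⊢
      exact_mod_cast this
    have h0 := Matrix.eq_zero_of_mulVec_eq_zero hF h'
    funext i
    have := congrFun h0 i
    simpa using this)⟩

/-- The similarity transformation `F Ψ[v] = Ψ[F v]^{1/|F|}`. -/
def simTransform (F : Matrix (Fin 2) (Fin 2) ℕ) (hF : detZ F ≠ 0) (v : Nplus) : StructureGroup :=
  dilog (act F hF v) ^ (1 / (detZ F : ℚ))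

/-- `(1, 0) ∈ N⁺`. -/
def e₁ : Nplus := ⟨![1, 0], by simp⟩

/-- `(0, 1) ∈ N⁺`. -/
def e₂ : Nplus := ⟨![0, 1], by simp⟩

end Dilog

end

/-! The linear map `simLin`, X_v ↦ |F|⁻¹ X_{Fv}, is a Lie algebra endomorphism because the skew form
scales by |F|. It never lowers degrees, so it acts on every G^{≤l} compatibly with the
Baker–Campbell–Hausdorff product and sends Ψ[v] to FΨ[v]. This transports the ordering relation
modulo G^{>l}; the point is the extra degree.

Once the factors of degree > l are discarded from C, the logarithms of the two sides in 𝔤^{≤l+1}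
differ only in degree l + 1. Off the axes F strictly raises degrees
(`exists_eq_zero_of_deg_act_eq`), so that part of the difference dies. No bracket has a component on
an axis, so axis coefficients of logarithms are additive on products (`axisHom`), and the
contributions of the outer powers m and n cancel. In degrees ≤ l the congruence then forces the
inner exponents on the e₁-axis to vanish (`exponent_eq_zero`), while v_j < e₂ excludes the e₂-axis.
Hence the axis coefficients also agree in degree l + 1, and `simGroup_eq_of_congrMod` applies. -/

noncomputable section

namespace Dilog

/-! ### The Baker–Campbell–Hausdorff product of commuting elements -/

attribute [local instance] LieRing.ofAssociativeRing

instance isLieAbelian_rat : IsLieAbelian ℚ where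
  trivial x y := by rw [Ring.lie_def, mul_comm, sub_self]

section BCH

variable {L : Type*} [LieRing L]

theorem nested_eq_zero_of_isLieAbelian [IsLieAbelian L] :
    ∀ w : List L, w.length ≠ 1 → nested w = 0
  | [], _ => rfl
  | [_], h => absurd rfl h
  | _ :: _ :: _, _ => trivial_lie_zero L L _ _

theorem bchIndex_of_sum_eq_one (p : BCHIndex) (h : (p.1.map fun q => q.1 + q.2).sum = 1) :
    p.1 = [(1, 0)] ∨ p.1 = [(0, 1)] := by
  obtain ⟨p, hne, hp⟩ := p
  match p, hne, hp with
  | [(r, s)], _, _ =>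
    simp only [List.map_cons, List.map_nil, List.sum_cons, List.sum_nil] at h
    simp only [List.cons.injEq, Prod.mk.injEq, and_true]
    omega
  | q :: q' :: t, _, hp =>
    have h1 := hp q (by simp)
    have h2 := hp q' (by simp)
    simp only [List.map_cons, List.sum_cons] at h
    omega

variable [LieAlgebra ℚ L]

/-- Only words of length one survive in an abelian Lie algebra, and just two indices produce them.
-/
theorem support_bchTerm_subset_of_isLieAbelian [IsLieAbelian L] (x y : L) :
    Function.support (bchTerm x y) ⊆
      (({⟨[(1, 0)], by simp⟩, ⟨[(0, 1)], by simp⟩} : Finset BCHIndex) : Set BCHIndex) := by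
  intro p hp
  have hlen : (p.1.map fun q => q.1 + q.2).sum = 1 := by
    by_contra h
    refine hp ?_
    rw [bchTerm, nested_eq_zero_of_isLieAbelian _ (by rwa [length_bchWord]), smul_zero]
  rcases bchIndex_of_sum_eq_one p hlen with h | h
  · simp [Subtype.ext_iff, h]
  · simp [Subtype.ext_iff, h]

theorem bch_of_isLieAbelian [IsLieAbelian L] (x y : L) : bch x y = x + y := by
  rw [bch, finsum_eq_sum_of_support_subset _ (support_bchTerm_subset_of_isLieAbelian x y),
    Finset.sum_pair (by simp)]
  simp [bchTerm, bchCoeff, bchWord, nested]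

/-- Finiteness is needed because `finsum` takes the value 0 on infinite supports, while the image
series may have finite support. -/
theorem map_bch {L' : Type*} [LieRing L'] [LieAlgebra ℚ L'] (f : L →ₗ⁅ℚ⁆ L') {x y : L}
    (h : (Function.support (bchTerm x y)).Finite) : f (bch x y) = bch (f x) (f y) := by
  unfold bch
  refine ((f : L →ₗ[ℚ] L').toAddMonoidHom.map_finsum h).trans ?_
  exact finsum_congr fun p => bchTerm_map f x y p

/-- The one-parameter subalgebra through `x`. -/
def lineHom (x : L) : ℚ →ₗ⁅ℚ⁆ L :=
  { LinearMap.toSpanSingleton ℚ L x with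
    map_lie' := by
      intro r s
      simp [trivial_lie_zero ℚ ℚ] }

/-- Transported from the abelian Lie algebra ℚ along `lineHom`. The cases with a zero coefficient
are the unit laws. -/
theorem bch_smul_smul (x : L) (r s : ℚ) : bch (r • x) (s • x) = (r + s) • x := by
  have h := map_bch (lineHom x) (x := r) (y := s)
    ((Finset.finite_toSet _).subset (support_bchTerm_subset_of_isLieAbelian r s))
  rw [bch_of_isLieAbelian] at h
  exact h.symm

theorem bch_zero (x : L) : bch x 0 = x := by simpa using bch_smul_smul x 1 0

theorem zero_bch (x : L) : bch 0 x = x := by simpa using bch_smul_smul x 0 1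

end BCH

namespace TruncGroup

variable {l : ℕ}

theorem log_mul (g h : TruncGroup l) : (g * h).log = bch g.log h.log := rfl

/-- `G^{≤l}` with multiplication and unit only: associativity is not asserted. -/
instance (l : ℕ) : MulOneClass (TruncGroup l) where
  one_mul g := TruncGroup.ext (zero_bch g.log)
  mul_one g := TruncGroup.ext (bch_zero g.log)

end TruncGroup

/-! ### Ordered finite products -/

/-- Trivial factors may be dropped from a list product. -/
theorem prod_map_filter_eq {ι M : Type*} [MulOneClass M] (f : ι → M) (p : ι → Bool) :
    ∀ w : List ι, (∀ i ∈ w, p i = false → f i = 1) →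
      ((w.filter p).map f).prod = (w.map f).prod
  | [], _ => rfl
  | i :: w, h => by
    have ih := prod_map_filter_eq f p w fun j hj => h j (List.mem_cons_of_mem _ hj)
    cases hp : p i with
    | true => simp [hp, ih]
    | false => simp [hp, ih, h i (by simp) hp]

theorem sort_filter {J : Type*} [LinearOrder J] (S : Finset J) (p : J → Prop) [DecidablePred p] :
    (S.filter p).sort (· ≤ ·) = (S.sort (· ≤ ·)).filter (fun j => decide (p j)) := by
  refine List.Perm.eq_of_pairwise' (r := (· ≤ ·)) (Finset.pairwise_sort _ _)
    ((Finset.pairwise_sort _ _).filter _) ?_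
  refine (List.perm_ext_iff_of_nodup (Finset.sort_nodup _ _)
    ((Finset.sort_nodup _ _).filter _)).mpr fun j => ?_
  simp

/-- Deleting units never regroups factors, so associativity plays no role. -/
theorem prod_sort_eq_of_subset {J M : Type*} [LinearOrder J] [MulOneClass M] (f : J → M)
    {S T : Finset J} (hST : S ⊆ T) (h : ∀ j ∈ T, j ∉ S → f j = 1) :
    ((S.sort (· ≤ ·)).map f).prod = ((T.sort (· ≤ ·)).map f).prod := by
  have hS : S = T.filter (· ∈ S) := by
    ext j
    simp only [Finset.mem_filter]
    exact ⟨fun hj => ⟨hST hj, hj⟩, And.right⟩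
  rw [hS, sort_filter]
  refine prod_map_filter_eq f _ _ fun j hj hjS => ?_
  exact h j (by simpa using hj) (by simpa using hjS)

/-- Ordered products over two finite sets agree if the factors outside the intersection are
trivial. -/
theorem prod_sort_congr {J M : Type*} [LinearOrder J] [MulOneClass M] (f : J → M)
    {S T : Finset J} (hS : ∀ j, j ∉ S → f j = 1) (hT : ∀ j, j ∉ T → f j = 1) :
    ((S.sort (· ≤ ·)).map f).prod = ((T.sort (· ≤ ·)).map f).prod := by
  rw [prod_sort_eq_of_subset f (S := S) (T := S ∪ T) Finset.subset_union_left fun j _ => hS j,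
    prod_sort_eq_of_subset f (S := T) (T := S ∪ T) Finset.subset_union_right fun j _ => hT j]

/-! ### Products and powers under the projections -/

namespace StructureGroup

theorem π_mul (l : ℕ) (g h : StructureGroup) : π l (g * h) = π l g * π l h := rfl

theorem log_π_pow (l : ℕ) (g : StructureGroup) (c : ℚ) :
    (π l (g ^ c)).log = c • (π l g).log := rfl

theorem π_list_prod (l : ℕ) : ∀ w : List StructureGroup, π l w.prod = (w.map (π l)).prod
  | [] => rfl
  | g :: w => by
    rw [List.prod_cons, π_mul, π_list_prod l w, List.map_cons, List.prod_cons]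

theorem π_finProd {J : Type*} [LinearOrder J] (l : ℕ) (S : Finset J) (f : J → StructureGroup) :
    π l (finProd S f) = ((S.sort (· ≤ ·)).map fun j => π l (f j)).prod := by
  rw [finProd, π_list_prod, List.map_map]
  rfl

theorem proj_π (l : ℕ) (g : StructureGroup) :
    LieAlg.proj (Nat.le_succ l) (π (l + 1) g).log = (π l g).log :=
  congrArg TruncGroup.log (g.compat l)

end StructureGroup

open LieAlg StructureGroup

/-! ### Truncated logarithms of dilogarithm elements -/

/-- The element `∑_{j=1}^l (-1)^{j+1}/j² X_{jv}` whose class is the logarithm of `π_l Ψ[v]`. -/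
def dilogLog (l : ℕ) (v : Nplus) : LieAlg :=
  ∑ i ∈ Finset.range l,
    ((-1 : ℚ) ^ ((i.succPNat : ℕ) + 1) / ((i.succPNat : ℕ) : ℚ) ^ 2) • X (nmul i.succPNat v)

theorem log_π_dilog (l : ℕ) (v : Nplus) : (π l (dilog v)).log = mk l (dilogLog l v) := rfl

theorem dilogLog_mem_gtSubmodule {l : ℕ} {v : Nplus} (h : l < deg v) :
    dilogLog l v ∈ gtSubmodule l := by
  refine Submodule.sum_mem _ fun i _ => Submodule.smul_mem _ _ (X_mem ?_)
  rw [deg_nmul]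
  exact h.trans_le (Nat.le_mul_of_pos_left _ i.succPNat.pos)

theorem π_dilog_pow_eq_one {l : ℕ} {v : Nplus} (h : l < deg v) (c : ℚ) :
    π l (dilog v ^ c) = 1 := by
  refine TruncGroup.ext ?_
  rw [log_π_pow, log_π_dilog, mk_eq_zero.mpr (dilogLog_mem_gtSubmodule h), smul_zero]
  rfl

theorem coeff_dilogLog_eq_zero {l : ℕ} {v w : Nplus} (h : ∀ j : ℕ+, nmul j v ≠ w) :
    coeff w (dilogLog l v) = 0 := by
  rw [dilogLog, map_sum]
  refine Finset.sum_eq_zero fun i _ => ?_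
  rw [map_smul, coeff_X, if_neg (h _), smul_zero]

theorem coeff_dilogLog_self {l : ℕ} (hl : 0 < l) (v : Nplus) : coeff v (dilogLog l v) = 1 := by
  -- The index 0 is the term j = 1; any other j has deg (jv) > deg v.
  rw [dilogLog, map_sum, Finset.sum_eq_single_of_mem 0 (by simpa using hl)]
  · rw [map_smul, coeff_X, if_pos (by apply Subtype.ext; simp [nmul])]
    simp
  · intro i _ hi
    rw [map_smul, coeff_X, if_neg, smul_zero]
    intro h
    have h1 := congrArg deg h
    rw [deg_nmul] at h1
    have h2 := deg_pos v
    have h3 : ((i.succPNat : ℕ+) : ℕ) = 1 := by nlinarith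
    exact hi (by simpa using h3)

/-! ### The coefficients on the axes -/

/-- If u + w lies on an axis, non-negativity puts both u and w on it, so they are collinear and {u,
w} = 0. -/
theorem coeff_lie_eq_zero {v : Nplus} {i : Fin 2} (hv : v.1 i = 0) (x y : LieAlg) :
    coeff v ⁅x, y⁆ = 0 := by
  have h : bracketLin.compr₂ (coeff v) = 0 := by
    refine hom_ext fun u => hom_ext fun w => ?_
    rw [LinearMap.compr₂_apply, bracketLin_X, map_smul, coeff_X]
    split_ifs with huw
    · have hi : u.1 i + w.1 i = 0 := by rw [← hv, ← huw]; rfl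
      have : skew u w = 0 := by
        fin_cases i <;> simp only [Fin.zero_eta, Fin.mk_one, Fin.isValue, Nat.add_eq_zero_iff] at hi <;>
          simp [skew, hi.1, hi.2]
      simp [this]
    · simp
  exact LinearMap.congr_fun (LinearMap.congr_fun h x) y

/-- On an axis, the coefficient of `X_v` is a homomorphism to an abelian Lie algebra. -/
def axisHom {l : ℕ} {v : Nplus} {i : Fin 2} (hv : v.1 i = 0) (hl : deg v ≤ l) :
    Trunc l →ₗ⁅ℚ⁆ ℚ :=
  { Submodule.liftQ (gtSubmodule l) (coeff v) fun _ hx => hx v hl with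
    map_lie' := by
      intro x y
      obtain ⟨x, rfl⟩ := mk_surjective l x
      obtain ⟨y, rfl⟩ := mk_surjective l y
      rw [← mk_lie]
      exact (coeff_lie_eq_zero hv x y).trans (trivial_lie_zero ℚ ℚ _ _).symm }

theorem axisHom_mk {l : ℕ} {v : Nplus} {i : Fin 2} (hv : v.1 i = 0) (hl : deg v ≤ l)
    (x : LieAlg) : axisHom hv hl (mk l x) = coeff v x := rfl

section axis

variable {l : ℕ} {v : Nplus} {i : Fin 2} (hv : v.1 i = 0) (hl : deg v ≤ l)

theorem axisHom_log_mul (g h : TruncGroup l) :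
    axisHom hv hl (g * h).log = axisHom hv hl g.log + axisHom hv hl h.log := by
  rw [TruncGroup.log_mul, map_bch _ (finite_support_bchTerm _ _), bch_of_isLieAbelian]

theorem axisHom_log_list_prod : ∀ w : List (TruncGroup l),
    axisHom hv hl w.prod.log = (w.map fun g => axisHom hv hl g.log).sum
  | [] => map_zero _
  | g :: w => by
    rw [List.prod_cons, axisHom_log_mul, axisHom_log_list_prod w, List.map_cons, List.sum_cons]

theorem axisHom_log_dilog_pow (w : Nplus) (c : ℚ) :
    axisHom hv hl (π l (dilog w ^ c)).log = c * coeff v (dilogLog l w) := by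
  rw [log_π_pow, map_smul, log_π_dilog, axisHom_mk, smul_eq_mul]

theorem axisHom_log_finProd {J : Type*} [LinearOrder J] (T : Finset J) (f : J → StructureGroup) :
    axisHom hv hl (π l (finProd T f)).log = ∑ j ∈ T, axisHom hv hl (π l (f j)).log := by
  rw [π_finProd, axisHom_log_list_prod, List.map_map, ← Finset.sum_map_toList]
  exact ((Finset.sort_perm_toList T (· ≤ ·)).map _).sum_eq

end axis

/-! ### The endomorphism attached to a matrix -/

section act

variable (F : Matrix (Fin 2) (Fin 2) ℕ) (hF : detZ F ≠ 0)

theorem act_val (v : Nplus) (i : Fin 2) :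
    (act F hF v).1 i = F i 0 * v.1 0 + F i 1 * v.1 1 := by
  change ∑ j, F i j * v.1 j = _
  rw [Fin.sum_univ_two]

theorem detZ_eq : detZ F = (F 0 0 : ℤ) * F 1 1 - F 0 1 * F 1 0 := by
  simp [detZ, Matrix.det_fin_two]

theorem skew_act (v w : Nplus) : skew (act F hF v) (act F hF w) = detZ F * skew v w := by
  simp only [skew, act_val, detZ_eq]
  push_cast
  ring

theorem act_add (v w : Nplus) : act F hF (v + w) = act F hF v + act F hF w :=
  Subtype.ext (Matrix.mulVec_add F v.1 w.1)

theorem act_nmul (j : ℕ+) (v : Nplus) : act F hF (nmul j v) = nmul j (act F hF v) :=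
  Subtype.ext (Matrix.mulVec_smul F (j : ℕ) v.1)

theorem act_injective : Function.Injective (act F hF) := by
  intro v w h
  have hd := detZ_eq F
  have h0 := congrArg (fun z : Nplus => (z.1 0 : ℤ)) h
  have h1 := congrArg (fun z : Nplus => (z.1 1 : ℤ)) h
  simp only [act_val] at h0 h1
  push_cast at h0 h1
  apply Subtype.ext
  funext i
  -- Cramer's rule: combine the two coordinate equations with entries of the adjugate.
  have key : detZ F * ((v.1 i : ℤ) - w.1 i) = 0 := by
    rw [hd]
    fin_cases i
    · simp only [Fin.zero_eta, Fin.isValue]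
      linear_combination (F 1 1 : ℤ) * h0 - F 0 1 * h1
    · simp only [Fin.mk_one, Fin.isValue]
      linear_combination (F 0 0 : ℤ) * h1 - F 1 0 * h0
  have := (mul_eq_zero.mp key).resolve_left hF
  omega

/-- Positivity of |F| preserves the sign of the skew form, and linearity preserves ratios of
collinear vectors. -/
theorem DilogLT.act {F : Matrix (Fin 2) (Fin 2) ℕ} (hF : 0 < detZ F) {v w : Nplus}
    (h : DilogLT v w) : DilogLT (act F hF.ne' v) (act F hF.ne' w) := by
  refine ⟨?_, (act_injective F hF.ne').ne h.2⟩
  rcases h.1 with h | ⟨k, hk, h⟩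
  · left
    rw [skew_act]
    exact mul_neg_of_pos_of_neg hF h
  · refine Or.inr ⟨k, hk, fun i => ?_⟩
    rw [act_val, act_val]
    push_cast
    rw [h 0, h 1]
    ring

theorem deg_act (v : Nplus) :
    deg (act F hF v) = (F 0 0 + F 1 0) * v.1 0 + (F 0 1 + F 1 1) * v.1 1 := by
  simp only [deg, act_val]
  ring

theorem one_le_column_sums {F : Matrix (Fin 2) (Fin 2) ℕ} (hF : detZ F ≠ 0) :
    1 ≤ F 0 0 + F 1 0 ∧ 1 ≤ F 0 1 + F 1 1 := by
  rw [detZ_eq] at hF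
  constructor <;>
  · by_contra h
    simp only [not_le, Nat.lt_one_iff, Nat.add_eq_zero_iff] at h
    simp [h.1, h.2] at hF

theorem deg_le_deg_act (v : Nplus) : deg v ≤ deg (act F hF v) := by
  obtain ⟨h1, h2⟩ := one_le_column_sums hF
  rw [deg_act, deg]
  nlinarith [Nat.zero_le (v.1 0), Nat.zero_le (v.1 1)]

/-- A matrix of positive determinant other than the identity raises the degree of every vector
off the axes. -/
theorem exists_eq_zero_of_deg_act_eq {F : Matrix (Fin 2) (Fin 2) ℕ} (hF : 0 < detZ F)
    (hne : F ≠ 1) {v : Nplus} (h : deg (act F hF.ne' v) = deg v) : ∃ i, v.1 i = 0 := by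
  by_contra! hv
  obtain ⟨h1, h2⟩ := one_le_column_sums hF.ne'
  have hv0 := Nat.pos_of_ne_zero (hv 0)
  have hv1 := Nat.pos_of_ne_zero (hv 1)
  rw [deg_act, deg] at h
  -- Both coordinates of v are positive, so equality of degrees forces both column sums to be 1. The
  -- columns are then basis vectors, and |F| > 0 leaves only the identity.
  have e1 : F 0 0 + F 1 0 = 1 := by nlinarith
  have e2 : F 0 1 + F 1 1 = 1 := by nlinarith
  rw [detZ_eq] at hF
  have c1 : (F 0 0 = 1 ∧ F 1 0 = 0) ∨ (F 0 0 = 0 ∧ F 1 0 = 1) := by omega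
  have c2 : (F 0 1 = 1 ∧ F 1 1 = 0) ∨ (F 0 1 = 0 ∧ F 1 1 = 1) := by omega
  rcases c1 with ⟨p, q⟩ | ⟨p, q⟩ <;> rcases c2 with ⟨r, s⟩ | ⟨r, s⟩ <;>
    simp [p, q, r, s] at hF
  refine hne ?_
  ext i j
  fin_cases i <;> fin_cases j <;> simp [p, q, r, s]

/-! ### The similarity transformation as a homomorphism -/

/-- The linear map `X_v ↦ |F|⁻¹ X_{F v}`. -/
def simLin : LieAlg →ₗ[ℚ] LieAlg :=
  (1 / (detZ F : ℚ)) • Finsupp.lmapDomain ℚ ℚ (act F hF)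

theorem simLin_X (v : Nplus) : simLin F hF (X v) = (1 / (detZ F : ℚ)) • X (act F hF v) := by
  simp [simLin, X, Finsupp.mapDomain_single]

/-- The bracket of two images carries |F|⁻² · |F| = |F|⁻¹, which is what dictates the normalisation.
-/
theorem simLin_lie (x y : LieAlg) : simLin F hF ⁅x, y⁆ = ⁅simLin F hF x, simLin F hF y⁆ := by
  have h : bracketLin.compr₂ (simLin F hF) =
      bracketLin.compl₁₂ (simLin F hF) (simLin F hF) := by
    refine hom_ext fun u => hom_ext fun w => ?_
    have hd : (detZ F : ℚ) ≠ 0 := by exact_mod_cast hF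
    simp only [LinearMap.compr₂_apply, LinearMap.compl₁₂_apply, bracketLin_X, map_smul,
      simLin_X, LinearMap.smul_apply, smul_smul, act_add, skew_act]
    congr 1
    push_cast
    field_simp
  exact LinearMap.congr_fun (LinearMap.congr_fun h x) y

theorem coeff_act_simLin (x : LieAlg) (v : Nplus) :
    coeff (act F hF v) (simLin F hF x) = 1 / (detZ F : ℚ) * coeff v x := by
  simp only [simLin, LinearMap.smul_apply, map_smul, smul_eq_mul]
  congr 1
  exact Finsupp.mapDomain_apply (act_injective F hF) x v

/-- The hypothesis is tested on the degree of Fv, not of v: this is where a degree can be gained. -/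
theorem simLin_mem_gtSubmodule {l : ℕ} {x : LieAlg}
    (hx : ∀ v, deg (act F hF v) ≤ l → coeff v x = 0) : simLin F hF x ∈ gtSubmodule l := by
  intro w hw
  by_cases h : w ∈ Set.range (act F hF)
  · obtain ⟨v, rfl⟩ := h
    rw [coeff_act_simLin, hx v hw, mul_zero]
  · simp only [simLin, LinearMap.smul_apply, map_smul]
    rw [show coeff w (Finsupp.lmapDomain ℚ ℚ (act F hF) x) = 0 from
      Finsupp.mapDomain_of_notMem_range x w h, smul_zero]

/-- The similarity transformation on `𝔤^{≤l}`. -/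
def simHom (l : ℕ) : Trunc l →ₗ⁅ℚ⁆ Trunc l :=
  { Submodule.mapQ (gtSubmodule l) (gtSubmodule l) (simLin F hF) (fun _ hx =>
      simLin_mem_gtSubmodule F hF fun v hv => hx v ((deg_le_deg_act F hF v).trans hv)) with
    map_lie' := by
      intro x y
      obtain ⟨x, rfl⟩ := mk_surjective l x
      obtain ⟨y, rfl⟩ := mk_surjective l y
      rw [← mk_lie]
      refine Eq.trans ?_ (mk_lie l (simLin F hF x) (simLin F hF y))
      rw [← simLin_lie]
      rfl }

theorem simHom_mk (l : ℕ) (x : LieAlg) : simHom F hF l (mk l x) = mk l (simLin F hF x) := rfl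

/-- The similarity transformation on `G^{≤l}`. -/
def simGroup {l : ℕ} (g : TruncGroup l) : TruncGroup l := TruncGroup.exp (simHom F hF l g.log)

theorem simGroup_mul {l : ℕ} (g h : TruncGroup l) :
    simGroup F hF (g * h) = simGroup F hF g * simGroup F hF h :=
  congrArg TruncGroup.exp (map_bch _ (finite_support_bchTerm _ _))

theorem simGroup_list_prod {l : ℕ} : ∀ w : List (TruncGroup l),
    simGroup F hF w.prod = (w.map (simGroup F hF)).prod
  | [] => congrArg TruncGroup.exp (map_zero _)
  | g :: w => by
    rw [List.prod_cons, simGroup_mul, simGroup_list_prod w, List.map_cons, List.prod_cons]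

theorem simLin_dilogLog (l : ℕ) (v : Nplus) :
    simLin F hF (dilogLog l v) = (1 / (detZ F : ℚ)) • dilogLog l (act F hF v) := by
  simp only [dilogLog, map_sum, map_smul, simLin_X, act_nmul, Finset.smul_sum]
  exact Finset.sum_congr rfl fun i _ => smul_comm _ _ _

theorem simGroup_dilog_pow (l : ℕ) (v : Nplus) (c : ℚ) :
    simGroup F hF (π l (dilog v ^ c)) = π l (simTransform F hF v ^ c) := by
  refine TruncGroup.ext ?_
  change simHom F hF l (c • mk l (dilogLog l v)) =
    c • (1 / (detZ F : ℚ)) • mk l (dilogLog l (act F hF v))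
  rw [map_smul, simHom_mk, simLin_dilogLog]
  rfl

theorem simTransform_pow (v : Nplus) (c : ℚ) :
    simTransform F hF v ^ c = dilog (act F hF v) ^ (c / (detZ F : ℚ)) := by
  refine StructureGroup.ext (funext fun l => TruncGroup.ext ?_)
  change c • (1 / (detZ F : ℚ)) • (π l (dilog (act F hF v))).log =
    (c / (detZ F : ℚ)) • (π l (dilog (act F hF v))).log
  rw [smul_smul, mul_one_div]

end act

/-! ### Bounded degree and trivial factors -/

theorem finite_setOf_deg_le (l : ℕ) : {v : Nplus | deg v ≤ l}.Finite := by
  refine Set.Finite.of_finite_image ((Set.finite_Iic (fun _ : Fin 2 => l)).subset ?_)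
    Subtype.val_injective.injOn
  rintro _ ⟨v, hv, rfl⟩ i
  have hv' : v.1 0 + v.1 1 ≤ l := hv
  fin_cases i <;> simp only [Fin.zero_eta, Fin.mk_one, Fin.isValue] <;> omega

theorem injective_of_dilogLT {J : Type*} [LinearOrder J] {v : J → Nplus}
    (h : ∀ i j, i < j → DilogLT (v i) (v j)) : Function.Injective v := by
  intro i j hij
  by_contra hne
  rcases lt_or_gt_of_ne hne with hlt | hlt
  · exact (h i j hlt).2 hij
  · exact (h j i hlt).2 hij.symm

/-- On the e₂-axis the order compares lengths, and e₂ is the shortest vector there. -/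
theorem pos_of_dilogLT_e₂ {v : Nplus} (h : DilogLT v e₂) : v.1 0 ≠ 0 := by
  intro h0
  rcases h with ⟨h | ⟨k, hk, h⟩, hne⟩
  · simp [skew, e₂, h0] at h
  · have h1 : (1 : ℚ) = k * v.1 1 := by simpa [e₂] using h 1
    have hv : 1 ≤ v.1 1 := by
      have := deg_pos v
      rw [deg] at this
      omega
    have hv' : (1 : ℚ) ≤ v.1 1 := by exact_mod_cast hv
    have h2 : (v.1 1 : ℚ) = 1 := by nlinarith
    refine hne (Subtype.ext (funext fun i => ?_))
    fin_cases i
    · simpa [e₂] using h0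
    · simpa [e₂] using (by exact_mod_cast h2 : v.1 1 = 1)

theorem deg_lt_of_nmul_eq {k : ℕ+} {v w : Nplus} (h : nmul k v = w) (hne : v ≠ w) :
    deg v < deg w := by
  rw [← h, deg_nmul]
  have hk : (k : ℕ) ≠ 1 := fun hk => hne (by
    rw [← h]
    apply Subtype.ext
    simp [nmul, hk])
  have := k.pos
  have := deg_pos v
  nlinarith [show 2 ≤ (k : ℕ) by omega]

theorem eq_zero_of_nmul_eq {k : ℕ+} {v w : Nplus} (h : nmul k v = w) {i : Fin 2}
    (hw : w.1 i = 0) : v.1 i = 0 := by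
  have h1 : (k : ℕ) * v.1 i = 0 := by rw [← hw, ← h]; rfl
  exact (Nat.mul_eq_zero.mp h1).resolve_left k.pos.ne'

theorem π_simTransform_pow_eq_one {F : Matrix (Fin 2) (Fin 2) ℕ} (hF : detZ F ≠ 0) {l : ℕ}
    {v : Nplus} (h : l < deg (act F hF v)) (c : ℚ) : π l (simTransform F hF v ^ c) = 1 := by
  rw [simTransform_pow]
  exact π_dilog_pow_eq_one h _

/-- Modulo `G^{>l}` an ordered product of dilogarithm powers involves the factors of degree `≤ l`
only. -/
theorem congrMod_finProd_of_isProd {J : Type*} [LinearOrder J] {v : J → Nplus} {u : J → ℚ}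
    {P : StructureGroup} (hP : IsProd (fun j => dilog (v j) ^ u j) P) {l : ℕ} {T : Finset J}
    (hT : ∀ j, deg (v j) ≤ l → j ∈ T) :
    CongrMod l P (finProd T fun j => dilog (v j) ^ u j) := by
  obtain ⟨S, hS, hPS⟩ := hP l
  rw [CongrMod, hPS, π_finProd]
  refine prod_sort_congr _ hS fun j hj => π_dilog_pow_eq_one ?_ _
  exact lt_of_not_ge fun h => hj (hT j h)

/-! ### Raising the degree of a congruence -/

/-- Exponents of dilogarithm elements on an axis vanish if all coefficients on this axis do. -/
theorem exponent_eq_zero {J : Type*} {v : J → Nplus} (hv : Function.Injective v) (u : J → ℚ)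
    {l L : ℕ} {i : Fin 2} (hL : 0 < L) {T : Finset J} (hT : ∀ j ∈ T, deg (v j) ≤ l)
    (H : ∀ w : Nplus, w.1 i = 0 → deg w ≤ l →
      ∑ j ∈ T, u j * coeff w (dilogLog L (v j)) = 0) :
    ∀ j ∈ T, (v j).1 i = 0 → u j = 0 := by
  suffices h : ∀ k, ∀ j ∈ T, deg (v j) = k → (v j).1 i = 0 → u j = 0 from
    fun j hj => h _ j hj rfl
  intro k
  induction k using Nat.strong_induction_on with
  | _ k ih =>
    intro j hj hjk hji
    have h := H (v j) hji (hT j hj)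
    -- Another v_{j'} contributes to X_{v_j} only if v_j is a multiple of it; then it lies on the
    -- same axis in smaller degree, and its exponent is already 0.
    rw [Finset.sum_eq_single_of_mem j hj, coeff_dilogLog_self hL, mul_one] at h
    · exact h
    · intro j' hj' hne
      by_cases hk : ∃ k : ℕ+, nmul k (v j') = v j
      · obtain ⟨k', hk'⟩ := hk
        rw [ih _ (hjk ▸ deg_lt_of_nmul_eq hk' (hv.ne hne)) j' hj' rfl
          (eq_zero_of_nmul_eq hk' hji), zero_mul]
      · rw [coeff_dilogLog_eq_zero (not_exists.mp hk), mul_zero]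

theorem exists_lift_sub_mem {l : ℕ} {g h : StructureGroup} (hgh : CongrMod l g h) :
    ∃ x y : LieAlg, mk (l + 1) x = (π (l + 1) g).log ∧ mk (l + 1) y = (π (l + 1) h).log ∧
      x - y ∈ gtSubmodule l := by
  obtain ⟨x, hx⟩ := mk_surjective (l + 1) (π (l + 1) g).log
  obtain ⟨y, hy⟩ := mk_surjective (l + 1) (π (l + 1) h).log
  refine ⟨x, y, hx, hy, ?_⟩
  have h1 : mk l x = mk l y := by
    rw [← proj_mk (Nat.le_succ l) x, ← proj_mk (Nat.le_succ l) y, hx, hy, proj_π, proj_π]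
    exact congrArg TruncGroup.log hgh
  exact (Submodule.Quotient.eq (gtSubmodule l)).mp h1

/-- If two elements agree modulo `G^{>l}` and have the same coefficients on the axes in degree
`l + 1`, then their images under a similarity transformation agree modulo `G^{>l+1}`. -/
theorem simGroup_eq_of_congrMod {F : Matrix (Fin 2) (Fin 2) ℕ} (hF : 0 < detZ F) (hne : F ≠ 1)
    {l : ℕ} {g h : StructureGroup} (hgh : CongrMod l g h)
    (H : ∀ (w : Nplus) (i : Fin 2) (hw : w.1 i = 0) (hl : deg w ≤ l + 1),
      axisHom hw hl (π (l + 1) g).log = axisHom hw hl (π (l + 1) h).log) :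
    simGroup F hF.ne' (π (l + 1) g) = simGroup F hF.ne' (π (l + 1) h) := by
  obtain ⟨x, y, hx, hy, hxy⟩ := exists_lift_sub_mem hgh
  refine congrArg TruncGroup.exp ?_
  rw [← hx, ← hy, simHom_mk, simHom_mk]
  refine (Submodule.Quotient.eq (gtSubmodule (l + 1))).mpr ?_
  rw [← map_sub]
  refine simLin_mem_gtSubmodule F hF.ne' fun w hw => ?_
  have hle := deg_le_deg_act F hF.ne' w
  by_cases hwl : deg w ≤ l
  · exact hxy w hwl
  -- Here deg w = deg (Fw) = l + 1, so w lies on an axis and `H` applies.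
  · obtain ⟨i, hi⟩ := exists_eq_zero_of_deg_act_eq hF hne (v := w) (by omega)
    have hl : deg w ≤ l + 1 := by omega
    have := H w i hi hl
    rw [← hx, ← hy, axisHom_mk, axisHom_mk] at this
    rw [map_sub, this, sub_self]

theorem axisHom_eq_of_congrMod {l : ℕ} {g h : StructureGroup} (hgh : CongrMod l g h)
    {w : Nplus} {i : Fin 2} (hw : w.1 i = 0) (hl : deg w ≤ l) (hl' : deg w ≤ l + 1) :
    axisHom hw hl' (π (l + 1) g).log = axisHom hw hl' (π (l + 1) h).log := by
  obtain ⟨x, y, hx, hy, hxy⟩ := exists_lift_sub_mem hgh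
  rw [← hx, ← hy, axisHom_mk, axisHom_mk, ← sub_eq_zero, ← map_sub]
  exact hxy w hl

/-- Truncated form of the ordering relation: it is transported by a similarity transformation,
gaining one degree. -/
theorem congrMod_simTransform {F : Matrix (Fin 2) (Fin 2) ℕ} (hF : 0 < detZ F) (hne : F ≠ 1)
    {J : Type*} [LinearOrder J] {v : J → Nplus} (hv : Function.Injective v) (u : J → ℚ)
    (hright : ∀ j, DilogLT (v j) e₂) (m n : ℚ) {l : ℕ} {T : Finset J}
    (hT : ∀ j ∈ T, deg (v j) ≤ l)
    (hC : CongrMod l (dilog e₂ ^ n * dilog e₁ ^ m)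
      (dilog e₁ ^ m * finProd T (fun j => dilog (v j) ^ u j) * dilog e₂ ^ n)) :
    CongrMod (l + 1) (simTransform F hF.ne' e₂ ^ n * simTransform F hF.ne' e₁ ^ m)
      (simTransform F hF.ne' e₁ ^ m * finProd T (fun j => simTransform F hF.ne' (v j) ^ u j) *
        simTransform F hF.ne' e₂ ^ n) := by
  -- Axis coefficients add up regardless of the order of factors, so the outer powers cancel.
  have key : ∀ (w : Nplus) (i : Fin 2) (hw : w.1 i = 0) (hl : deg w ≤ l + 1),
      axisHom hw hl (π (l + 1) (dilog e₂ ^ n * dilog e₁ ^ m)).log =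
        axisHom hw hl (π (l + 1)
          (dilog e₁ ^ m * finProd T (fun j => dilog (v j) ^ u j) * dilog e₂ ^ n)).log ↔
      ∑ j ∈ T, u j * coeff w (dilogLog (l + 1) (v j)) = 0 := by
    intro w i hw hl
    simp only [π_mul, axisHom_log_mul, axisHom_log_finProd, axisHom_log_dilog_pow]
    constructor <;> intro h <;> linarith
  -- Vanishing of coordinate 1 means the e₁-axis; degrees ≤ l are covered by the congruence itself.
  have hu : ∀ j ∈ T, (v j).1 1 = 0 → u j = 0 :=
    exponent_eq_zero hv u (Nat.succ_pos l) hT fun w hw hl =>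
      (key w 1 hw (by omega)).mp (axisHom_eq_of_congrMod hC hw hl (by omega))
  have main := simGroup_eq_of_congrMod hF hne hC fun w i hw hl => (key w i hw hl).mpr <| by
    -- A contributing v_j lies on the axis of w: the e₂-axis is impossible by `hright`, and on the
    -- e₁-axis the exponent is zero by `hu`.
    refine Finset.sum_eq_zero fun j hj => ?_
    by_cases hk : ∃ k : ℕ+, nmul k (v j) = w
    · obtain ⟨k, hk⟩ := hk
      have hj0 := eq_zero_of_nmul_eq hk hw
      fin_cases i
      · exact absurd hj0 (pos_of_dilogLT_e₂ (hright j))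
      · rw [hu j hj hj0, zero_mul]
    · rw [coeff_dilogLog_eq_zero (not_exists.mp hk), mul_zero]
  simp only [π_mul, simGroup_mul, π_finProd, simGroup_list_prod, List.map_map,
    Function.comp_def, simGroup_dilog_pow] at main
  simpa only [CongrMod, π_mul, π_finProd] using main

end Dilog

end

/-! ### The theorem -/

open Dilog StructureGroup in
theorem mainTheorem4 (a b c d : ℕ) (hab : ![a, b] ≠ 0) (hcd : ![c, d] ≠ 0)
    (hdet : 0 < detZ !![a, c; b, d]) (hne : !![a, c; b, d] ≠ 1)
    (m n : ℕ) (hm : 0 < m) (hn : 0 < n)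
    {J : Type*} [LinearOrder J] (v : J → Nplus) (u : J → ℚ)
    (hord : ∀ i j, i < j → DilogLT (v i) (v j))
    (hleft : ∀ j, DilogLT e₁ (v j)) (hright : ∀ j, DilogLT (v j) e₂)
    (P : StructureGroup) (hP : IsProd (fun j => dilog (v j) ^ u j) P)
    (l : ℕ) (hl : 0 < l)
    (hC : CongrMod l (dilog e₂ ^ (n : ℚ) * dilog e₁ ^ (m : ℚ))
      (dilog e₁ ^ (m : ℚ) * P * dilog e₂ ^ (n : ℚ))) :
    ∃ S : Finset J,
      (∀ j, j ∈ S ↔ deg (v j) ≤ l ∧ deg (act !![a, c; b, d] hdet.ne' (v j)) ≤ l + 1) ∧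
      (DilogLT ⟨![a, b], hab⟩ ⟨![c, d], hcd⟩ ∧
        (∀ j ∈ S, DilogLT ⟨![a, b], hab⟩ (act !![a, c; b, d] hdet.ne' (v j)) ∧
          DilogLT (act !![a, c; b, d] hdet.ne' (v j)) ⟨![c, d], hcd⟩) ∧
        (∀ i ∈ S, ∀ j ∈ S, i < j →
          DilogLT (act !![a, c; b, d] hdet.ne' (v i)) (act !![a, c; b, d] hdet.ne' (v j)))) ∧
      CongrMod (l + 1)
        (dilog ⟨![c, d], hcd⟩ ^ ((n : ℚ) / (detZ !![a, c; b, d] : ℚ)) *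
          dilog ⟨![a, b], hab⟩ ^ ((m : ℚ) / (detZ !![a, c; b, d] : ℚ)))
        (dilog ⟨![a, b], hab⟩ ^ ((m : ℚ) / (detZ !![a, c; b, d] : ℚ)) *
          finProd S (fun j => simTransform !![a, c; b, d] hdet.ne' (v j) ^ u j) *
          dilog ⟨![c, d], hcd⟩ ^ ((n : ℚ) / (detZ !![a, c; b, d] : ℚ))) := by
  have he₁ : (⟨![a, b], hab⟩ : Nplus) = act !![a, c; b, d] hdet.ne' e₁ := by
    apply Subtype.ext
    funext i
    rw [act_val]
    fin_cases i <;> simp [e₁]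
  have he₂ : (⟨![c, d], hcd⟩ : Nplus) = act !![a, c; b, d] hdet.ne' e₂ := by
    apply Subtype.ext
    funext i
    rw [act_val]
    fin_cases i <;> simp [e₂]
  rw [he₁, he₂, ← simTransform_pow, ← simTransform_pow]
  have hv := injective_of_dilogLT hord
  have hfin : {j | deg (v j) ≤ l}.Finite := (finite_setOf_deg_le l).preimage hv.injOn
  have hT : ∀ j, j ∈ hfin.toFinset ↔ deg (v j) ≤ l := fun j => hfin.mem_toFinset
  have h₁₂ : DilogLT e₁ e₂ :=
    ⟨Or.inl (by simp [skew, e₁, e₂]), fun h => by simpa [e₁, e₂] using congrArg (·.1 0) h⟩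
  refine ⟨hfin.toFinset.filter fun j => deg (act !![a, c; b, d] hdet.ne' (v j)) ≤ l + 1,
    fun j => by rw [Finset.mem_filter, hT], ⟨h₁₂.act hdet, fun j _ =>
      ⟨(hleft j).act hdet, (hright j).act hdet⟩, fun i _ j _ hij => (hord i j hij).act hdet⟩, ?_⟩
  -- The product is truncated before passing to degree l + 1: the hypothesis does not control
  -- factors of degree l + 1, and one on the e₁-axis could spoil the comparison there.
  have hP' := congrMod_finProd_of_isProd hP fun j => (hT j).mpr
  have main := congrMod_simTransform hdet hne hv u hright m n (fun j => (hT j).mp)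
    (by simpa only [CongrMod, π_mul, show π l P = _ from hP'] using hC)
  -- Factors with deg (F v_j) > l + 1 are trivial in G^{≤l+1}.
  have htrim := prod_sort_eq_of_subset
    (fun j => π (l + 1) (simTransform !![a, c; b, d] hdet.ne' (v j) ^ u j))
    (Finset.filter_subset (fun j => deg (act !![a, c; b, d] hdet.ne' (v j)) ≤ l + 1)
      hfin.toFinset) fun j hj hjS => π_simTransform_pow_eq_one hdet.ne' (by
        by_contra h
        exact hjS (Finset.mem_filter.mpr ⟨hj, not_lt.mp h⟩)) _
  simpa only [CongrMod, π_mul, π_finProd, htrim] using main
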